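/- Setting. Let $V$ be a finite non-empty set of vertices with a metric $\ell$ (the complete metric graph on $V$; $\ell(u,v)$ is the travel time), and let every vertex $v$ have a weight $\phi(v)>0$. A robot follows an infinite timed walk $(v_1,t_1),(v_2,t_2),\dots$, starting at time $0$: it waits for time $t_i\ge 0$ at $v_i$ and then moves to $v_{i+1}$ in time $\ell(v_i,v_{i+1})$; its total duration is infinite. For a family $\mathcal W$ of walks the latency $L(\mathcal W,v)$ is the supremum, over consecutive visits of the robots to $v$, of the time between a departure from $v$ and the next arrival at $v$ (it is $\infty$ if $v$ is not visited at arbitrarily late times). The maximum weighted latency of $\mathcal W$ is $\max_v \phi(v)L(\mathcal W,v)$, and $\mathrm{OPT}_1$ is the infimum of the maximum weighted latency over all single walks. There is no recharging constraint. For $\emptyset\ne S\subseteq V$ put $M_S=\max_S\phi$ and $\rho_S=\max_{u,v\in S}\phi(u)/\phi(v)$; let $\hat\rho_S=\rho_S+1$ if $\rho_S$ is a power of two (including $1=2^0$) and $\hat\rho_S=\rho_S$ otherwise. All logarithms are to base $2$. The weight classes of $S$ are $S_i=\{v\in S: M_S/2^{i+1}<\phi(v)\le M_S/2^i\}$ for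 $0\le i<K_S=\lceil\log\hat\rho_S\rceil$. Write $\rho=\rho_V$, $\hat\rho=\hat\rho_V$, $K=K_V=\lceil\log\hat\rho\rceil$, and let $V_i$ be the weight classes of $V$. A tour of $S$ is a cyclic ordering of $S$ (each vertex exactly once). Let $\mathrm{TOUR}$ be any subroutine that returns for every $S\subseteq V$ a tour of $S$ of length at most $3/2$ times the minimum length of a tour of $S$. Single-robot algorithm on $S$. For every class $S_i$ cut $\mathrm{TOUR}(S_i)$, of length $T_i$, into $2^i$ consecutive (possibly empty) walks $W_{i,0},\dots,W_{i,2^i-1}$, where $W_{i,j}$ contains the vertices at distance from the start of the tour in $[jT_i/2^i,(j+1)T_i/2^i)$ (if $T_i=0$, the only vertex is put in $W_{i,0}$). For $k=1,\dots,2^{K_S}$ let $B_k$ be the concatenation of $W_{i,\,k\bmod 2^i}$ for $i=0,\dots,K_S-1$. The robot repeats $B_1B_2\cdots B_{2^{K_S}}$ periodically without waiting. (If $|S|=1$ it stays at the vertex of $S$; if $S=\emptyset$ it stays at an arbitrary vertex.) Algorithm LatencyWalks with $R\ge 1$ robots. (a) If $R<\log\hat\rho$: for $j=1,\dots,R$ robot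 $j$ runs the single-robot algorithm on the union of the $V_i$ with $\lceil\frac{j-1}{R}\log\hat\rho\rceil\le i<\lceil\frac jR\log\hat\rho\rceil$. (b) If $R\ge\log\hat\rho$: assign $\lfloor R/K\rfloor$ robots to every class $V_0,\dots,V_{K-1}$; then assign the remaining robots one at a time, each to a class whose maximum weighted latency with its currently assigned robots is largest. The $n$ robots finally assigned to a class $V_i$ are equally spaced on $\mathrm{TOUR}(V_i)$, that is, each follows the one ahead at a distance of $1/n$ times the length of the tour. (Robots of an empty class stay at an arbitrary vertex.) Proposition. For every such instance, every such $\mathrm{TOUR}$ and every $R\ge1$, the $R$ walks constructed by Algorithm LatencyWalks have maximum weighted latency at most $$\Bigl(\frac{8\log\rho}{R}+10\Bigr)\mathrm{OPT}_1\quad\text{if }R\le\log\rho,\qquad\text{and at most}\qquad \frac{3\,\mathrm{OPT}_1}{\lfloor R/\lceil\log\hat\rho\rceil\rfloor}\quad\text{if }R>\log\rho .$$ -/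

import Mathlib

open scoped ENNReal

namespace Patrol

noncomputable section

/-! ### Timed walks and latency on a complete metric graph -/

/-- An infinite timed walk of one robot: the `i`-th vertex visited and the time spent there.  The
graph is complete, with edge lengths `dist`; a repeated vertex just means that the robot waits.  The
last field says that the walk goes on for ever. -/
structure TimedWalk (V : Type*) [MetricSpace V] where
  vertex : ℕ → V
  hold : ℕ → ℝ
  hold_nonneg : ∀ i, 0 ≤ hold i
  unbounded : ∀ B : ℝ, ∃ i : ℕ,
    B ≤ ∑ s ∈ Finset.range i, (hold s + dist (vertex s) (vertex (s + 1)))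

variable {V : Type*} [MetricSpace V]

/-- Arrival time at the `i`-th vertex of the walk; the walk starts at time `0`. -/
def TimedWalk.arrival (W : TimedWalk V) (i : ℕ) : ℝ :=
  ∑ s ∈ Finset.range i, (W.hold s + dist (W.vertex s) (W.vertex (s + 1)))

/-- Some robot of the family `W` is at the vertex `v` at time `t`. -/
def Present {ι : Type*} (W : ι → TimedWalk V) (v : V) (t : ℝ) : Prop :=
  ∃ r i, (W r).vertex i = v ∧ (W r).arrival i ≤ t ∧ t ≤ (W r).arrival i + (W r).hold i

open Classical in
/-- Latency of `v`: the supremum of the lengths of the time intervals, after the first visit to `v`,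
during which no robot is at `v`, that is the supremum of (next arrival) - (departure).  It is
infinite if `v` is never visited, or is visited for the last time at some moment. -/
def latency {ι : Type*} (W : ι → TimedWalk V) (v : V) : ℝ≥0∞ :=
  if ∃ t, Present W v t then
    ⨆ (a : ℝ) (b : ℝ) (_ : (∃ s, s ≤ a ∧ Present W v s) ∧
      ∀ t, a < t → t < b → ¬ Present W v t), ENNReal.ofReal (b - a)
  else ⊤

/-- Maximum weighted latency of a family of walks. -/
def maxCost {ι : Type*} (φ : V → ℝ) (W : ι → TimedWalk V) : ℝ≥0∞ :=
  ⨆ v, ENNReal.ofReal (φ v) * latency W v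

/-- Optimal maximum weighted latency of a single robot (no recharging constraint). -/
def optOne (φ : V → ℝ) : ℝ≥0∞ :=
  ⨅ W : TimedWalk V, maxCost φ (fun _ : Unit => W)

/-! ### Tours and the walks that follow them -/

variable [Nonempty V]

/-- The list `l`, repeated periodically (a fixed arbitrary vertex if `l` is empty). -/
def cyc (l : List V) (i : ℕ) : V := l.getD (i % l.length) (Classical.arbitrary V)

/-- Distance travelled along the periodic repetition of `l` from its start to position `i`. -/
def cumLen (l : List V) (i : ℕ) : ℝ :=
  ∑ s ∈ Finset.range i, dist (cyc l s) (cyc l (s + 1))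

/-- Length of the closed walk `l`, including the step from the last vertex back to the first. -/
def tourLength (l : List V) : ℝ := cumLen l l.length

/-- `l` is a tour of the vertex set `S`: it lists every vertex of `S` exactly once. -/
def IsTour (S : Finset V) (l : List V) : Prop := l.Nodup ∧ ∀ v, v ∈ l ↔ v ∈ S

/-- `l` is a tour of `S` of length at most `α` times the length of a shortest tour of `S`. -/
def IsApproxTour (α : ℝ) (S : Finset V) (l : List V) : Prop :=
  IsTour S l ∧ ∀ l', IsTour S l' → tourLength l ≤ α * tourLength l'

theorem cumLen_mono (l : List V) : Monotone (cumLen l) := by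
  refine monotone_nat_of_le_succ fun n => ?_
  simp only [cumLen, Finset.sum_range_succ]
  linarith [dist_nonneg (x := cyc l n) (y := cyc l (n + 1))]

theorem cumLen_mul (l : List V) (N : ℕ) : cumLen l (N * l.length) = N * tourLength l := by
  have hper : ∀ M i, cyc l (M * l.length + i) = cyc l i := by
    intro M i
    simp [cyc]
  induction N with
  | zero => simp [cumLen]
  | succ N ih =>
    have h : cumLen l ((N + 1) * l.length) = cumLen l (N * l.length) + tourLength l := by
      rw [Nat.succ_mul, cumLen, Finset.sum_range_add]
      simp only [tourLength, cumLen, add_assoc, hper]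
    rw [h, ih]
    push_cast
    ring

open Classical in
/-- Start at position `q` of the closed walk `l`, wait there for time `h`, then go round `l` for
ever.  A closed walk of length zero has only one vertex: there the robot just stays. -/
def tourWalk (l : List V) (q : ℕ) (h : ℝ) : TimedWalk V where
  vertex i := cyc l (q + i)
  hold i := (if i = 0 then max h 0 else 0) + (if tourLength l = 0 then 1 else 0)
  hold_nonneg i := by positivity
  unbounded B := by
    by_cases hT : tourLength l = 0
    · obtain ⟨n, hn⟩ := exists_nat_ge B
      refine ⟨n, hn.trans ?_⟩
      have : (n : ℝ) = ∑ _s ∈ Finset.range n, (1 : ℝ) := by simp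
      rw [this]
      refine Finset.sum_le_sum fun s _ => ?_
      rw [if_pos hT]
      have h1 : (0 : ℝ) ≤ if s = 0 then max h 0 else 0 := by positivity
      linarith [dist_nonneg (x := cyc l (q + s)) (y := cyc l (q + (s + 1)))]
    · have hT' : 0 < tourLength l :=
        lt_of_le_of_ne (by unfold tourLength cumLen; positivity) (Ne.symm hT)
      obtain ⟨n, hn⟩ := exists_nat_ge ((B + cumLen l q) / tourLength l)
      refine ⟨n * l.length, ?_⟩
      rw [div_le_iff₀ hT', ← cumLen_mul] at hn
      have h1 : cumLen l (n * l.length) ≤ cumLen l (q + n * l.length) :=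
        cumLen_mono l (Nat.le_add_left _ _)
      have h2 : cumLen l (q + n * l.length) = cumLen l q +
          ∑ s ∈ Finset.range (n * l.length), dist (cyc l (q + s)) (cyc l (q + (s + 1))) := by
        rw [cumLen, Finset.sum_range_add]
        rfl
      have h3 : ∑ s ∈ Finset.range (n * l.length), dist (cyc l (q + s)) (cyc l (q + (s + 1))) ≤
          ∑ s ∈ Finset.range (n * l.length), (((if s = 0 then max h 0 else 0) +
            (if tourLength l = 0 then 1 else 0)) + dist (cyc l (q + s)) (cyc l (q + (s + 1)))) := by
        refine Finset.sum_le_sum fun s _ => ?_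
        have h4 : (0 : ℝ) ≤ (if s = 0 then max h 0 else 0) +
          (if tourLength l = 0 then 1 else 0) := by positivity
        linarith
      linarith

/-- Robot `m` of `n` robots equally spaced on the closed walk `l` of length `T`: at time `t` it is at
distance `m * T / n + t` along `l`.  As robots start at vertices, it waits at the first vertex at or
after distance `m * T / n` until it would have got there. -/
def spacedWalk (l : List V) (n m : ℕ) : TimedWalk V :=
  let x : ℝ := m * tourLength l / n
  let q : ℕ := sInf {q : ℕ | x ≤ cumLen l q}
  tourWalk l q (cumLen l q - x)

/-! ### Weight classes -/

/-- The ratio `ρ` of the maximum to the minimum weight on `S`. -/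
def weightRatio (φ : V → ℝ) (S : Finset V) : ℝ := ⨆ p : S × S, φ p.1 / φ p.2

open Classical in
/-- The ratio used by the algorithms: increased by one if it is a power of two. -/
def adjRatio (φ : V → ℝ) (S : Finset V) : ℝ :=
  if ∃ k : ℕ, weightRatio φ S = 2 ^ k then weightRatio φ S + 1 else weightRatio φ S

/-- The number of weight classes. -/
def numClasses (φ : V → ℝ) (S : Finset V) : ℕ := ⌈Real.logb 2 (adjRatio φ S)⌉₊

open Classical in
/-- The `i`-th weight class of `S`, for `i = 0, 1, ...`: weights in `(M / 2 ^ (i + 1), M / 2 ^ i]`,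
where `M` is the maximum weight on `S`. -/
def weightClass (φ : V → ℝ) (S : Finset V) (i : ℕ) : Finset V :=
  S.filter fun v => (⨆ u : S, φ u) / 2 ^ (i + 1) < φ v ∧ φ v ≤ (⨆ u : S, φ u) / 2 ^ i

/-! ### The single-robot algorithm -/

open Classical in
/-- Part `j` of the closed walk `l` of length `T` cut into `m` consecutive walks: the vertices whose
distance from the start lies in `[j * T / m, (j + 1) * T / m)`. -/
def piece (l : List V) (m j : ℕ) : List V :=
  ((List.range l.length).filter fun q => ⌊cumLen l q * m / tourLength l⌋₊ = j).map (cyc l)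

/-- One period of the single-robot walk for the vertex set `S`: the tour of weight class `i` is cut
into `2 ^ i` walks, and block `k` visits the walk number `k mod 2 ^ i` of every class `i` in turn. -/
def singleRobotPeriod (φ : V → ℝ) (tour : Finset V → List V) (S : Finset V) : List V :=
  (List.range (2 ^ numClasses φ S)).flatMap fun k =>
    (List.range (numClasses φ S)).flatMap fun i =>
      piece (tour (weightClass φ S i)) (2 ^ i) ((k + 1) % 2 ^ i)

/-- The single-robot walk for the vertex set `S` (it stays at some vertex if `S` is empty). -/
def singleRobotWalk (φ : V → ℝ) (tour : Finset V → List V) (S : Finset V) : TimedWalk V :=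
  tourWalk (singleRobotPeriod φ tour S) 0 0

/-! ### The multi-robot algorithm -/

variable [Fintype V]

open Classical in
/-- The vertex set given to robot `j = 0, ..., R - 1` when there are few robots. -/
def robotPart (φ : V → ℝ) (R j : ℕ) : Finset V :=
  Finset.univ.filter fun v => ∃ i : ℕ,
    ⌈(j : ℝ) / R * Real.logb 2 (adjRatio φ Finset.univ)⌉₊ ≤ i ∧
    i < ⌈((j : ℝ) + 1) / R * Real.logb 2 (adjRatio φ Finset.univ)⌉₊ ∧
    v ∈ weightClass φ Finset.univ i

/-- Maximum weighted latency on class `i` when `n` robots are equally spaced on its tour. -/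
def classCost (φ : V → ℝ) (tour : Finset V → List V) (i n : ℕ) : ℝ≥0∞ :=
  ⨆ v ∈ weightClass φ Finset.univ i, ENNReal.ofReal (φ v) *
    latency (fun m : Fin n => spacedWalk (tour (weightClass φ Finset.univ i)) n m) v

/-- The class to which each robot is assigned when there are many robots, after `s` extra robots.
At first every class gets `⌊R / K⌋` robots, `K` being the number of classes; then each further robot
joins the (first) class that has the maximum cost with its current robots. -/
def assignment (φ : V → ℝ) (tour : Finset V → List V) (R : ℕ) : ℕ → List ℕ
  | 0 => (List.range (numClasses φ (Finset.univ : Finset V))).flatMap fun i =>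
      List.replicate (R / numClasses φ (Finset.univ : Finset V)) i
  | s + 1 =>
      let l := assignment φ tour R s
      l ++ [sInf {i : ℕ | i < numClasses φ (Finset.univ : Finset V) ∧
        ∀ j < numClasses φ (Finset.univ : Finset V),
          classCost φ tour j (l.count j) ≤ classCost φ tour i (l.count i)}]

/-- The assignment of all `R` robots. -/
def finalAssignment (φ : V → ℝ) (tour : Finset V → List V) (R : ℕ) : List ℕ :=
  assignment φ tour R (R - numClasses φ (Finset.univ : Finset V) *
    (R / numClasses φ (Finset.univ : Finset V)))

open Classical in
/-- Algorithm LatencyWalks without recharging constraint, with `tour` as the tour subroutine. -/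
def latencyWalks (φ : V → ℝ) (tour : Finset V → List V) (R : ℕ) (r : Fin R) : TimedWalk V :=
  if (R : ℝ) < Real.logb 2 (adjRatio φ (Finset.univ : Finset V)) then
    singleRobotWalk φ tour (robotPart φ R r)
  else
    let l := finalAssignment φ tour R
    let i := l.getD r 0
    spacedWalk (tour (weightClass φ Finset.univ i)) (l.count i) ((l.take r).count i)

end

end Patrol

set_option linter.unusedSectionVars false

namespace Patrol

variable {V : Type*} [MetricSpace V]

/-! ### Timed walks -/

namespace TimedWalk

variable (W : TimedWalk V)

/-! Two lower bounds on the single-robot optimum carry everything. A walk of finite cost must leave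
`u`, reach `w` and return within the latency of `u`, so `2 * φ u * dist u w ≤ OPT`
(`mul_dist_le_optOne`). And if all vertices of `S` have latency at most `C`, some tour of `S` has
length at most `C` (`exists_tour_le_of_latency_le`): around a nearly longest absence from a vertex
of `S`, the loop from that vertex to itself meets all of `S`. With `M` the maximum weight, it
follows that the approximate tour of class `i` has length `T` with `M * T ≤ 3 * 2 ^ i * OPT`.

Many robots: `n` equally spaced robots leave gaps of at most `T / n`, weights in class `i` are at
most `M / 2 ^ i`, and every class has at least `⌊R / K⌋` robots.

Few robots: one robot on a set with `K` classes and maximum weight `M` traverses a sequence of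
pieces. A piece costs at most `3 * OPT / M` inside and `OPT / M` to reach the next one; a given
piece of class `i` recurs every `K * 2 ^ i` pieces. The weighted latency is thus at most `4 * (K +
1) * OPT`, and a robot's share has at most `log ρ̂ / R + 1` classes. The two cases of the algorithm
match those of the bound because, for an integer `R`, `R < log ρ̂` is equivalent to `R ≤ log ρ`. -/

theorem arrival_succ (i : ℕ) :
    W.arrival (i + 1) = W.arrival i + W.hold i + dist (W.vertex i) (W.vertex (i + 1)) := by
  simp only [arrival, Finset.sum_range_succ]
  ring

theorem departure_le_arrival_succ (i : ℕ) : W.arrival i + W.hold i ≤ W.arrival (i + 1) := by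
  rw [arrival_succ]
  linarith [dist_nonneg (x := W.vertex i) (y := W.vertex (i + 1))]

theorem arrival_mono : Monotone W.arrival :=
  monotone_nat_of_le_succ fun i => by
    linarith [W.departure_le_arrival_succ i, W.hold_nonneg i]

theorem arrival_nonneg (i : ℕ) : 0 ≤ W.arrival i := by
  simpa [arrival] using W.arrival_mono (Nat.zero_le i)

theorem departure_le_arrival {i j : ℕ} (h : i < j) : W.arrival i + W.hold i ≤ W.arrival j :=
  (W.departure_le_arrival_succ i).trans (W.arrival_mono h)

theorem departure_mono {i j : ℕ} (h : i ≤ j) :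
    W.arrival i + W.hold i ≤ W.arrival j + W.hold j := by
  rcases h.eq_or_lt with rfl | h
  · rfl
  · linarith [W.departure_le_arrival h, W.hold_nonneg j]

theorem departure_add_sum_le {i j : ℕ} (h : i < j) :
    W.arrival i + W.hold i + ∑ s ∈ Finset.Ico i j, dist (W.vertex s) (W.vertex (s + 1)) ≤
      W.arrival j := by
  induction j, h using Nat.le_induction with
  | base => simp [arrival_succ]
  | succ j h ih =>
    rw [Finset.sum_Ico_succ_top (by omega), arrival_succ]
    linarith [W.hold_nonneg j]

theorem departure_add_dist_le {i j : ℕ} (h : i < j) :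
    W.arrival i + W.hold i + dist (W.vertex i) (W.vertex j) ≤ W.arrival j := by
  linarith [W.departure_add_sum_le h, dist_le_Ico_sum_dist W.vertex h.le]

theorem exists_index {a : ℝ} (ha : 0 ≤ a) :
    ∃ k, W.arrival k ≤ a ∧ ∀ i, k < i → a < W.arrival i := by
  classical
  have hex : ∃ i, a < W.arrival i := by
    obtain ⟨i, hi⟩ := W.unbounded (a + 1)
    exact ⟨i, by unfold arrival; linarith⟩
  have h0 : Nat.find hex ≠ 0 := by
    intro h
    have := Nat.find_spec hex
    rw [h] at this
    simp [arrival] at this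
    linarith
  refine ⟨Nat.find hex - 1, not_lt.1 (Nat.find_min hex (by omega)), fun i hi => ?_⟩
  exact (Nat.find_spec hex).trans_le (W.arrival_mono (by omega))

end TimedWalk

/-! ### Latency -/

section Latency

variable {ι : Type*} {W : ι → TimedWalk V} {v : V}

theorem Present.nonneg {t : ℝ} (h : Present W v t) : 0 ≤ t := by
  obtain ⟨r, i, -, h, -⟩ := h
  exact ((W r).arrival_nonneg i).trans h

theorem present_arrival (r : ι) (i : ℕ) : Present W ((W r).vertex i) ((W r).arrival i) :=
  ⟨r, i, rfl, le_rfl, by linarith [(W r).hold_nonneg i]⟩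

theorem present_departure (r : ι) (i : ℕ) :
    Present W ((W r).vertex i) ((W r).arrival i + (W r).hold i) :=
  ⟨r, i, rfl, by linarith [(W r).hold_nonneg i], le_rfl⟩

theorem exists_present_of_latency_ne_top (h : latency W v ≠ ⊤) : ∃ t, Present W v t := by
  by_contra hn
  exact h (by rw [latency, if_neg hn])

theorem sub_le_of_latency_le {C : ℝ} (hC : 0 ≤ C) (h : latency W v ≤ ENNReal.ofReal C)
    {s a b : ℝ} (hs : s ≤ a) (hp : Present W v s)
    (hab : ∀ t, a < t → t < b → ¬ Present W v t) : b - a ≤ C := by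
  rw [latency, if_pos ⟨s, hp⟩] at h
  refine (ENNReal.ofReal_le_ofReal_iff hC).1 (le_trans ?_ h)
  exact le_iSup_of_le a <| le_iSup_of_le b <| le_iSup_of_le ⟨⟨s, hs, hp⟩, hab⟩ le_rfl

theorem latency_le {L : ℝ} (hL : ∀ t, 0 ≤ t → ∃ t', t ≤ t' ∧ t' ≤ t + L ∧ Present W v t') :
    latency W v ≤ ENNReal.ofReal L := by
  obtain ⟨t₀, -, -, h₀⟩ := hL 0 le_rfl
  rw [latency, if_pos ⟨t₀, h₀⟩]
  refine iSup_le fun a => iSup_le fun b => iSup_le fun ⟨⟨s, hs, hp⟩, hab⟩ => ?_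
  refine ENNReal.ofReal_le_ofReal ?_
  by_contra! hlt
  -- The window of length `L` centred in `(a, b)` lies strictly inside it when `L < b - a`.
  obtain ⟨t', h1, h2, h3⟩ := hL ((a + b - L) / 2) (by linarith [hp.nonneg, hL])
  exact hab t' (by linarith) (by linarith) h3

end Latency

/-! ### Lower bounds for a single walk -/

section LowerBound

variable {W : TimedWalk V}

/-- Take the last visit to `u` up to index `k` and the first one after it. Nobody is at `u` in
between, so the latency bounds the gap; without a later visit, arbitrarily long gaps would arise. -/
theorem exists_loop {u : V} {C : ℝ} (hC : 0 ≤ C)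
    (h : latency (fun _ : Unit => W) u ≤ ENNReal.ofReal C) {i₀ k : ℕ} (hk : i₀ ≤ k)
    (hu : W.vertex i₀ = u) :
    ∃ i j, i ≤ k ∧ k < j ∧ W.vertex i = u ∧ W.vertex j = u ∧
      W.arrival j ≤ W.arrival i + W.hold i + C := by
  classical
  set i := Nat.findGreatest (fun n => W.vertex n = u) k with hi
  have hiu : W.vertex i = u := Nat.findGreatest_spec (P := fun n => W.vertex n = u) hk hu
  have hik : i ≤ k := Nat.findGreatest_le k
  have hnot : ∀ r, i < r → r ≤ k → W.vertex r ≠ u := fun r h1 h2 =>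
    Nat.findGreatest_is_greatest h1 h2
  have hpi : Present (fun _ : Unit => W) u (W.arrival i + W.hold i) := by
    have := present_departure (W := fun _ : Unit => W) () i
    rwa [hiu] at this
  have hex : ∃ j, k < j ∧ W.vertex j = u := by
    by_contra! hn
    have := sub_le_of_latency_le hC h le_rfl hpi (b := W.arrival i + W.hold i + C + 1) ?_
    · linarith
    rintro t ht - ⟨_, r, hr, h1, h2⟩
    dsimp only at hr h1 h2
    rcases le_or_gt r i with hri | hri
    · linarith [W.departure_mono hri]
    · rcases le_or_gt r k with hrk | hrk
      · exact hnot r hri hrk hr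
      · exact hn r hrk hr
  refine ⟨i, Nat.find hex, hik, (Nat.find_spec hex).1, hiu, (Nat.find_spec hex).2, ?_⟩
  have := sub_le_of_latency_le hC h le_rfl hpi (b := W.arrival (Nat.find hex)) ?_
  · linarith
  rintro t ht ht' ⟨_, r, hr, h1, h2⟩
  dsimp only at hr h1 h2
  rcases le_or_gt r i with hri | hri
  · linarith [W.departure_mono hri]
  · rcases le_or_gt r k with hrk | hrk
    · exact hnot r hri hrk hr
    · have : Nat.find hex ≤ r := Nat.find_min' hex ⟨hrk, hr⟩
      linarith [W.arrival_mono this]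

theorem exists_vertex_eq_of_latency_ne_top {v : V}
    (h : latency (fun _ : Unit => W) v ≠ ⊤) : ∃ i, W.vertex i = v := by
  obtain ⟨t, _, i, hi, -⟩ := exists_present_of_latency_ne_top h
  exact ⟨i, hi⟩

/-- Finite latency at `w` forces a visit to `w` after a visit to `u`; the loop at `u` around it
contains a trip to `w` and back. -/
theorem two_mul_dist_le_of_latency_le {u w : V} {C : ℝ} (hC : 0 ≤ C)
    (hu : latency (fun _ : Unit => W) u ≤ ENNReal.ofReal C)
    (hw : latency (fun _ : Unit => W) w ≠ ⊤) : 2 * dist u w ≤ C := by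
  obtain ⟨i₀, h0⟩ := exists_vertex_eq_of_latency_ne_top (ne_top_of_le_ne_top ENNReal.ofReal_ne_top hu)
  obtain ⟨j₀, h1⟩ := exists_vertex_eq_of_latency_ne_top hw
  obtain ⟨-, k, -, hk, -, hkw, -⟩ := exists_loop ENNReal.toReal_nonneg
    (ENNReal.ofReal_toReal hw).ge (le_max_right i₀ j₀) h1
  obtain ⟨i, j, hik, hkj, hi, hj, hij⟩ := exists_loop hC hu (k := k)
    ((le_max_left i₀ j₀).trans hk.le) h0
  have h2 := W.departure_add_dist_le hkj
  rw [hkw, hj, dist_comm] at h2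
  rcases hik.eq_or_lt with rfl | hik
  · rw [← hi, hkw, dist_self]
    simpa using hC
  · have h3 := W.departure_add_dist_le hik
    rw [hkw, hi] at h3
    linarith [W.hold_nonneg k]

end LowerBound

/-! ### Shortcutting closed walks -/

theorem sum_dist_comp_le (x : ℕ → V) (q : ℕ → ℕ) {m : ℕ} (hq : ∀ s < m, q s ≤ q (s + 1)) :
    q 0 ≤ q m ∧ ∑ s ∈ Finset.range m, dist (x (q s)) (x (q (s + 1))) ≤
      ∑ s ∈ Finset.Ico (q 0) (q m), dist (x s) (x (s + 1)) := by
  induction m with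
  | zero => simp
  | succ m ih =>
    obtain ⟨h1, h2⟩ := ih fun s hs => hq s (by omega)
    have h3 := hq m (by omega)
    refine ⟨h1.trans h3, ?_⟩
    rw [Finset.sum_range_succ, ← Finset.sum_Ico_consecutive _ h1 h3]
    exact add_le_add h2 (dist_le_Ico_sum_dist x h3)

variable [Nonempty V]

theorem cyc_of_lt (l : List V) {i : ℕ} (h : i < l.length) : cyc l i = l[i] := by
  simp [cyc, Nat.mod_eq_of_lt h, h]

theorem cyc_mul_add (l : List V) (N i : ℕ) : cyc l (N * l.length + i) = cyc l i := by
  simp [cyc]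

theorem cyc_length (l : List V) : cyc l l.length = cyc l 0 := by
  simpa using cyc_mul_add l 1 0

theorem cyc_mem {l : List V} (h : l ≠ []) (i : ℕ) : cyc l i ∈ l := by
  have hlt : i % l.length < l.length := Nat.mod_lt _ (List.length_pos_iff.2 h)
  rw [cyc, List.getD_eq_getElem _ _ hlt]
  exact List.getElem_mem hlt

theorem exists_cyc_eq {l : List V} {v : V} (h : v ∈ l) : ∃ i < l.length, cyc l i = v := by
  obtain ⟨i, hi, rfl⟩ := List.getElem_of_mem h
  exact ⟨i, hi, cyc_of_lt l hi⟩

/-- Keep one visit to each vertex of `S`, in order of time, and shortcut by the triangle inequality.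
The closing edge is paid for by the two ends of the walk, which meet at `x i = x j`. -/
theorem exists_tour_of_closed_walk (x : ℕ → V) {i j : ℕ} (hx : x i = x j)
    (S : Finset V) (hS : ∀ v ∈ S, ∃ k, i ≤ k ∧ k < j ∧ x k = v) :
    ∃ l, IsTour S l ∧ tourLength l ≤ ∑ s ∈ Finset.Ico i j, dist (x s) (x (s + 1)) := by
  classical
  choose! p hp using hS
  set Q := (S.image p).sort (· ≤ ·) with hQ
  have hmem : ∀ k, k ∈ Q ↔ ∃ v ∈ S, p v = k := by simp [hQ]
  have hsort : Q.Pairwise (· ≤ ·) := by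
    rw [hQ]; exact Finset.pairwise_sort _ _
  have hl : ∀ v, v ∈ Q.map x ↔ v ∈ S := by
    intro v
    simp only [List.mem_map, hmem]
    constructor
    · rintro ⟨_, ⟨w, hw, rfl⟩, rfl⟩
      rwa [(hp w hw).2.2]
    · exact fun hv => ⟨p v, ⟨v, hv, rfl⟩, (hp v hv).2.2⟩
  refine ⟨Q.map x, ⟨?_, hl⟩, ?_⟩
  · refine List.Nodup.map_on ?_ (by rw [hQ]; exact Finset.sort_nodup _ _)
    intro a ha b hb hab
    obtain ⟨v, hv, rfl⟩ := (hmem a).1 ha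
    obtain ⟨w, hw, rfl⟩ := (hmem b).1 hb
    rw [(hp v hv).2.2, (hp w hw).2.2] at hab
    rw [hab]
  · rcases hlen : Q.length with _ | m
    · rw [tourLength, List.length_map, hlen]
      simp only [cumLen, Finset.range_zero, Finset.sum_empty]
      exact Finset.sum_nonneg fun _ _ => dist_nonneg
    · have hcyc : ∀ s ≤ m, cyc (Q.map x) s = x (Q.getD s 0) := by
        intro s hs
        rw [cyc_of_lt _ (by simp; omega), List.getElem_map, List.getD_eq_getElem _ _ (by omega)]
      have hbd : ∀ s ≤ m, i ≤ Q.getD s 0 ∧ Q.getD s 0 < j := by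
        intro s hs
        have : Q.getD s 0 ∈ Q := by
          rw [List.getD_eq_getElem _ _ (by omega)]; exact List.getElem_mem _
        obtain ⟨v, hv, h⟩ := (hmem _).1 this
        rw [← h]
        exact ⟨(hp v hv).1, (hp v hv).2.1⟩
      have hmono : ∀ s < m, Q.getD s 0 ≤ Q.getD (s + 1) 0 := by
        intro s hs
        rw [List.getD_eq_getElem _ _ (by omega), List.getD_eq_getElem _ _ (by omega)]
        exact List.pairwise_iff_getElem.1 hsort s (s + 1) _ _ (by omega)
      obtain ⟨h1, h2⟩ := sum_dist_comp_le x (fun s => Q.getD s 0) hmono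
      have hlast : cyc (Q.map x) (m + 1) = x (Q.getD 0 0) := by
        rw [← hcyc 0 (by omega), ← cyc_length, List.length_map, hlen]
      rw [tourLength, List.length_map, hlen, cumLen, Finset.sum_range_succ, hlast, hcyc m le_rfl,
        Finset.sum_congr rfl fun s hs => by
          rw [hcyc s (Finset.mem_range.1 hs).le, hcyc (s + 1) (Finset.mem_range.1 hs)],
        ← Finset.sum_Ico_consecutive _ (hbd 0 (by omega)).1
          (h1.trans (hbd m le_rfl).2.le), ← Finset.sum_Ico_consecutive _ h1 (hbd m le_rfl).2.le]
      have h3 := dist_le_Ico_sum_dist x (hbd m le_rfl).2.le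
      have h4 := dist_le_Ico_sum_dist x (hbd 0 (by omega)).1
      have h5 := dist_triangle (x (Q.getD m 0)) (x i) (x (Q.getD 0 0))
      rw [← hx] at h3
      linarith

/-- If the longest absence of all belongs to `u`, every other vertex of `S` must be met during it.
The supremum need not be attained, so an absence within `ε` of it is used; the excess, below `2 *
ε`, is too short to travel from `u` to another vertex of `S`. -/
theorem exists_tour_le_of_latency_le {W : TimedWalk V} {S : Finset V} {C : ℝ} (hC : 0 ≤ C)
    (h : ∀ v ∈ S, latency (fun _ : Unit => W) v ≤ ENNReal.ofReal C) :
    ∃ l, IsTour S l ∧ tourLength l ≤ C := by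
  classical
  rcases S.eq_empty_or_nonempty with rfl | hne
  · exact ⟨[], ⟨by simp, by simp⟩, by simpa [tourLength, cumLen] using hC⟩
  have hvis : ∀ v ∈ S, ∃ i, W.vertex i = v := fun v hv =>
    exists_vertex_eq_of_latency_ne_top (ne_top_of_le_ne_top ENNReal.ofReal_ne_top (h v hv))
  choose! p hp using hvis
  obtain ⟨k₀, hk₀⟩ : ∃ k₀, ∀ v ∈ S, p v ≤ k₀ := ⟨S.sup p, fun v hv => Finset.le_sup hv⟩
  set T₀ := W.arrival k₀ with hT₀
  have hpres : ∀ v ∈ S, Present (fun _ : Unit => W) v (W.arrival (p v)) := by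
    intro v hv
    have := present_arrival (W := fun _ : Unit => W) () (p v)
    rwa [hp v hv] at this
  -- a lower bound for the distances
  obtain ⟨ε, hε, hdist⟩ : ∃ ε > 0, ∀ v ∈ S, ∀ w ∈ S, v ≠ w → 2 * ε ≤ dist v w := by
    rcases (S.offDiag).eq_empty_or_nonempty with he | he
    · refine ⟨1, one_pos, fun v hv w hw hvw => ?_⟩
      have : (v, w) ∈ S.offDiag := Finset.mem_offDiag.2 ⟨hv, hw, hvw⟩
      simp [he] at this
    · obtain ⟨q, hq, hmin⟩ := S.offDiag.exists_min_image (fun q => dist q.1 q.2) he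
      rw [Finset.mem_offDiag] at hq
      refine ⟨dist q.1 q.2 / 2, half_pos (dist_pos.2 hq.2.2), fun v hv w hw hvw => ?_⟩
      have := hmin (v, w) (Finset.mem_offDiag.2 ⟨hv, hw, hvw⟩)
      dsimp only at this
      linarith
  -- Lengths of absences from vertices of `S`, counted only after time `T₀`, by which all of `S` has
  -- been visited, so that the latencies bound them.
  set G : Set ℝ := {d | ∃ v ∈ S, ∃ a, T₀ ≤ a ∧
    ∀ t, a < t → t < a + d → ¬ Present (fun _ : Unit => W) v t} with hG
  have hGne : G.Nonempty := by
    obtain ⟨v, hv⟩ := hne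
    exact ⟨0, v, hv, T₀, le_rfl, fun t h1 h2 => by linarith⟩
  have hGb : BddAbove G := by
    refine ⟨C, ?_⟩
    rintro d ⟨v, hv, a, ha, hd⟩
    have := sub_le_of_latency_le hC (h v hv)
      ((W.arrival_mono (hk₀ v hv)).trans ha) (hpres v hv) hd
    linarith
  obtain ⟨d, ⟨u, hu, a, ha, hd⟩, hlt⟩ := exists_lt_of_lt_csSup hGne (sub_lt_self (sSup G) hε)
  obtain ⟨k, hka, hk⟩ := W.exists_index ((W.arrival_nonneg k₀).trans ha)
  have hk₀k : k₀ ≤ k := by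
    by_contra! hlt
    linarith [hk k₀ hlt]
  obtain ⟨i, j, hik, hkj, hi, hj, hij⟩ := exists_loop hC (h u hu) ((hk₀ u hu).trans hk₀k) (hp u hu)
  have hbj : a + d ≤ W.arrival j := by
    by_contra! hlt
    refine hd _ (hk j hkj) hlt ?_
    have := present_arrival (W := fun _ : Unit => W) () j
    rwa [hj] at this
  suffices hcov : ∀ w ∈ S, ∃ r, i ≤ r ∧ r < j ∧ W.vertex r = w by
    obtain ⟨l, hl, hle⟩ := exists_tour_of_closed_walk W.vertex
      (hi.trans hj.symm) S hcov
    exact ⟨l, hl, by linarith [W.departure_add_sum_le (hik.trans_lt hkj)]⟩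
  intro w hw
  rcases eq_or_ne w u with rfl | hwu
  · exact ⟨i, le_rfl, hik.trans_lt hkj, hi⟩
  obtain ⟨t, h1, h2, _, r, hr, h3, h4⟩ : ∃ t, a < t ∧ t < a + (sSup G + ε) ∧
      Present (fun _ : Unit => W) w t := by
    by_contra! hn
    have := le_csSup hGb (⟨w, hw, a, ha, hn⟩ : sSup G + ε ∈ G)
    linarith
  dsimp only at hr h3 h4
  refine ⟨r, ?_, ?_, hr⟩
  · by_contra! hri
    linarith [W.departure_le_arrival hri, W.arrival_mono hik]
  · by_contra! hjr
    -- A visit to `w` after the return to `u` would start at least `2 * ε` after time `a + d`,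
    -- whereas `w` is met before `a + sSup G + ε < a + d + 2 * ε`.
    rcases hjr.eq_or_lt with rfl | hjr
    · exact hwu (hr.symm.trans hj)
    · have h5 := W.departure_add_dist_le hjr
      rw [hj, hr] at h5
      linarith [hdist u hu w hw hwu.symm, W.hold_nonneg j]

/-! ### Lower bounds for the optimum of a single robot -/

section Optimum

variable {φ : V → ℝ}

theorem latency_le_of_maxCost_ne_top {ι : Type*} (hφ : ∀ v, 0 < φ v) {W : ι → TimedWalk V}
    (h : maxCost φ W ≠ ⊤) (v : V) :
    latency W v ≤ ENNReal.ofReal ((maxCost φ W).toReal / φ v) := by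
  rw [ENNReal.ofReal_div_of_pos (hφ v), ENNReal.ofReal_toReal h, ENNReal.le_div_iff_mul_le
    (Or.inl (by simpa using hφ v)) (Or.inl ENNReal.ofReal_ne_top), mul_comm]
  exact le_iSup (fun v => ENNReal.ofReal (φ v) * latency W v) v

theorem le_optOne_toReal {z : ℝ} (htop : optOne φ ≠ ⊤)
    (h : ∀ W : TimedWalk V, maxCost φ (fun _ : Unit => W) ≠ ⊤ →
      z ≤ (maxCost φ (fun _ : Unit => W)).toReal) : z ≤ (optOne φ).toReal := by
  rw [← ENNReal.ofReal_le_iff_le_toReal htop]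
  refine le_iInf fun W => ?_
  by_cases hW : maxCost φ (fun _ : Unit => W) = ⊤
  · simp [hW]
  · exact (ENNReal.ofReal_le_iff_le_toReal hW).2 (h W hW)

theorem mul_dist_le_optOne (hφ : ∀ v, 0 < φ v) (htop : optOne φ ≠ ⊤) (u w : V) :
    2 * φ u * dist u w ≤ (optOne φ).toReal := by
  refine le_optOne_toReal htop fun W hW => ?_
  have := two_mul_dist_le_of_latency_le (div_nonneg ENNReal.toReal_nonneg (hφ u).le)
    (latency_le_of_maxCost_ne_top hφ hW u)
    (ne_top_of_le_ne_top ENNReal.ofReal_ne_top (latency_le_of_maxCost_ne_top hφ hW w))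
  rw [le_div_iff₀ (hφ u)] at this
  linarith

theorem mul_tourLength_le_optOne (hφ : ∀ v, 0 < φ v) (htop : optOne φ ≠ ⊤) {S : Finset V}
    {l : List V} {α m : ℝ} (hα : 0 < α) (hl : IsApproxTour α S l) (hm : 0 < m)
    (hS : ∀ v ∈ S, m ≤ φ v) : m * tourLength l ≤ α * (optOne φ).toReal := by
  rw [← div_le_iff₀' hα]
  refine le_optOne_toReal htop fun W hW => ?_
  obtain ⟨l', hl', hle⟩ := exists_tour_le_of_latency_le
    (div_nonneg (ENNReal.toReal_nonneg (a := maxCost φ (fun _ : Unit => W))) hm.le)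
    (fun v hv => (latency_le_of_maxCost_ne_top hφ hW v).trans
      (ENNReal.ofReal_le_ofReal (div_le_div_of_nonneg_left ENNReal.toReal_nonneg hm (hS v hv))))
  rw [le_div_iff₀ hm] at hle
  rw [div_le_iff₀' hα]
  calc m * tourLength l ≤ m * (α * tourLength l') := by gcongr; exact hl.2 l' hl'
    _ = α * (tourLength l' * m) := by ring
    _ ≤ _ := by gcongr

end Optimum

/-! ### Walks that follow a tour -/

theorem dist_cyc_le (l : List V) {a b : ℕ} (h : a ≤ b) :
    dist (cyc l a) (cyc l b) ≤ cumLen l b - cumLen l a := by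
  rw [cumLen, cumLen, ← Finset.sum_Ico_eq_sub _ h]
  exact dist_le_Ico_sum_dist (cyc l) h

theorem cumLen_zero (l : List V) : cumLen l 0 = 0 := by simp [cumLen]

theorem cumLen_nonneg (l : List V) (i : ℕ) : 0 ≤ cumLen l i :=
  (cumLen_zero l).symm.le.trans (cumLen_mono l (Nat.zero_le i))

theorem tourLength_nonneg (l : List V) : 0 ≤ tourLength l := cumLen_nonneg l _

theorem cumLen_mul_add (l : List V) (N i : ℕ) :
    cumLen l (N * l.length + i) = N * tourLength l + cumLen l i := by
  rw [← cumLen_mul, cumLen, Finset.sum_range_add]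
  simp only [cumLen, add_assoc, cyc_mul_add]

theorem cyc_eq_of_tourLength_eq_zero {l : List V} (hT : tourLength l = 0) (i : ℕ) :
    cyc l i = cyc l 0 := by
  have h : ∀ i, cumLen l i = 0 := by
    intro i
    refine le_antisymm ?_ (cumLen_nonneg l i)
    rcases Nat.eq_zero_or_pos l.length with h0 | h0
    · rw [List.length_eq_zero_iff] at h0
      subst h0
      simp [cumLen, cyc]
    · calc cumLen l i ≤ cumLen l (i * l.length) := cumLen_mono l (Nat.le_mul_of_pos_right i h0)
        _ = 0 := by rw [cumLen_mul, hT, mul_zero]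
  have h2 := dist_cyc_le l (Nat.zero_le i)
  rw [h, h, sub_zero] at h2
  exact (dist_le_zero.1 h2).symm

/-- For `q > 0` the vertex differs from the first one, so a positive distance remains. The
strictness keeps piece indices below the number of pieces. -/
theorem cumLen_lt_tourLength {l : List V} (hl : l.Nodup) (hT : tourLength l ≠ 0) {q : ℕ}
    (hq : q < l.length) : cumLen l q < tourLength l := by
  rcases Nat.eq_zero_or_pos q with rfl | h0
  · rw [cumLen_zero]
    exact (tourLength_nonneg l).lt_of_ne' hT
  · have h1 := dist_cyc_le l hq.le
    have h2 : cyc l q ≠ cyc l l.length := by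
      rw [cyc_length, cyc_of_lt l hq, cyc_of_lt l (h0.trans hq)]
      intro h
      exact h0.ne' ((hl.getElem_inj_iff).1 h)
    have := dist_pos.2 h2
    rw [tourLength]
    linarith

theorem Present.of_single {ι : Type*} {W : ι → TimedWalk V} {v : V} {t : ℝ} (r : ι)
    (h : Present (fun _ : Unit => W r) v t) : Present W v t := by
  obtain ⟨_, i, h⟩ := h
  exact ⟨r, i, h⟩

theorem present_tourWalk_of_tourLength_eq_zero {l : List V} (hT : tourLength l = 0) {v : V}
    (hv : v ∈ l) (q : ℕ) (h : ℝ) {t : ℝ} (ht : 0 ≤ t) :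
    Present (fun _ : Unit => tourWalk l q h) v t := by
  have hall : ∀ i, (tourWalk l q h).vertex i = v := by
    obtain ⟨i, -, rfl⟩ := exists_cyc_eq hv
    intro k
    exact (cyc_eq_of_tourLength_eq_zero hT _).trans (cyc_eq_of_tourLength_eq_zero hT _).symm
  obtain ⟨k, h1, h2⟩ := (tourWalk l q h).exists_index ht
  refine ⟨(), k, hall k, h1, ?_⟩
  have := h2 (k + 1) (Nat.lt_succ_self k)
  rw [TimedWalk.arrival_succ, hall, hall, dist_self] at this
  linarith

theorem arrival_tourWalk_succ {l : List V} (hT : tourLength l ≠ 0) (q : ℕ) {h : ℝ} (hh : 0 ≤ h)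
    (i : ℕ) :
    (tourWalk l q h).arrival (i + 1) = h + cumLen l (q + (i + 1)) - cumLen l q := by
  have hs : ∀ j, cumLen l (j + 1) = cumLen l j + dist (cyc l j) (cyc l (j + 1)) := fun j => by
    rw [cumLen, Finset.sum_range_succ, cumLen]
  induction i with
  | zero =>
    rw [TimedWalk.arrival_succ]
    simp [TimedWalk.arrival, tourWalk, hT, hh, hs]
    ring
  | succ i ih =>
    rw [TimedWalk.arrival_succ, ih, ← add_assoc q (i + 1) 1, hs]
    simp [tourWalk, hT, add_assoc]
    ring

theorem present_tourWalk {l : List V} (hT : tourLength l ≠ 0) {q p : ℕ} (hqp : q ≤ p) {h : ℝ}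
    (hh : 0 ≤ h) :
    Present (fun _ : Unit => tourWalk l q h) (cyc l p) (h + cumLen l p - cumLen l q) := by
  obtain ⟨i, rfl⟩ := Nat.exists_eq_add_of_le hqp
  rcases i with _ | i
  · have := present_departure (W := fun _ : Unit => tourWalk l q h) () 0
    simpa [TimedWalk.arrival, tourWalk, hT, hh] using this
  · have := present_arrival (W := fun _ : Unit => tourWalk l q h) () (i + 1)
    rwa [arrival_tourWalk_succ hT q hh] at this

/-- Robot `m` passes position `p` on lap `k` at time `cumLen l p + (k * n - m) * T / n`. Over all `k
≥ 0` and `m < n`, `k * n - m` takes every integer value above `-n`, so passages are `T / n` apart.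
-/
theorem exists_present_spacedWalk {l : List V} (hl : l.Nodup) {v : V} (hv : v ∈ l) {n : ℕ}
    (hn : 0 < n) {t : ℝ} (ht : 0 ≤ t) :
    ∃ m < n, ∃ t', t ≤ t' ∧ t' ≤ t + tourLength l / n ∧
      Present (fun _ : Unit => spacedWalk l n m) v t' := by
  have hn' : (0 : ℝ) < n := by exact_mod_cast hn
  by_cases hT : tourLength l = 0
  · exact ⟨0, hn, t, le_rfl, by simp [hT],
      present_tourWalk_of_tourLength_eq_zero hT hv _ _ ht⟩
  have hT' : 0 < tourLength l := (tourLength_nonneg l).lt_of_ne' hT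
  obtain ⟨p, hp, rfl⟩ := exists_cyc_eq hv
  have hlt := cumLen_lt_tourLength hl hT hp
  set T := tourLength l with hTdef
  set z : ℤ := ⌈(t - cumLen l p) * n / T⌉ with hz
  -- Holds since `t ≥ 0` and `cumLen l p < T`; it makes the lap number `k` nonnegative.
  have hzn : -(n : ℤ) < z := by
    rw [hz, Int.lt_ceil]
    push_cast
    rw [lt_div_iff₀ hT']
    nlinarith
  have hnz : (n : ℤ) ≠ 0 := by omega
  have hn0 : (0 : ℤ) < n := by omega
  obtain ⟨m, hm⟩ := Int.eq_ofNat_of_zero_le (Int.emod_nonneg (-z) hnz)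
  have hmn : m < n := by
    have := Int.emod_lt_of_pos (-z) hn0
    omega
  have hdiv := Int.mul_ediv_add_emod (-z) n
  obtain ⟨k, hk⟩ : ∃ k : ℕ, (k : ℤ) = -(-z / n) := by
    refine ⟨(-(-z / n)).toNat, Int.toNat_of_nonneg ?_⟩
    have : -z / n < 1 := Int.ediv_lt_of_lt_mul hn0 (by omega)
    omega
  have hzk : z = k * n - m := by
    rw [hk, ← hm]
    linarith
  have hzk' : (z : ℝ) = k * n - m := by exact_mod_cast hzk
  have h1 : (t - cumLen l p) * n / T ≤ z := Int.le_ceil _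
  have h2 : (z : ℝ) < (t - cumLen l p) * n / T + 1 := Int.ceil_lt_add_one _
  have htime : cumLen l (k * l.length + p) - m * T / n = cumLen l p + z * T / n := by
    rw [cumLen_mul_add, hzk', ← hTdef]
    field_simp
    ring
  have h3 : t ≤ cumLen l (k * l.length + p) - m * T / n := by
    rw [htime]
    rw [div_le_iff₀ hT', ← le_div_iff₀ hn'] at h1
    linarith
  have h4 : cumLen l (k * l.length + p) - m * T / n ≤ t + T / n := by
    rw [htime]
    rw [← sub_lt_iff_lt_add, lt_div_iff₀ hT', ← div_lt_iff₀ hn'] at h2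
    have : (z - 1) * T / n = z * T / n - T / n := by ring
    linarith
  refine ⟨m, hmn, _, h3, h4, ?_⟩
  -- The robot starts at the least position in `Q`; the passage found lies in `Q`, hence is not
  -- before the start.
  set Q : Set ℕ := {q : ℕ | m * T / n ≤ cumLen l q} with hQ
  have hmem : k * l.length + p ∈ Q := by
    change m * T / n ≤ cumLen l (k * l.length + p)
    linarith
  have hq : m * T / n ≤ cumLen l (sInf Q) := Nat.sInf_mem ⟨_, hmem⟩
  have := present_tourWalk hT (Nat.sInf_le hmem) (sub_nonneg.2 hq)
  rw [cyc_mul_add, show ∀ a b c : ℝ, a - b + c - a = c - b by intros; ring] at this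
  exact this

/-! ### Weight classes -/

section Weights

variable {φ : V → ℝ} {S : Finset V}

theorem le_iSup_weight (φ : V → ℝ) {v : V} (hv : v ∈ S) : φ v ≤ ⨆ u : S, φ u :=
  le_ciSup (f := fun u : S => φ u) (Set.finite_range _).bddAbove ⟨v, hv⟩

theorem exists_eq_iSup_weight (φ : V → ℝ) (hS : S.Nonempty) : ∃ x ∈ S, φ x = ⨆ u : S, φ u := by
  have := hS.to_subtype
  obtain ⟨x, hx⟩ := exists_eq_ciSup_of_finite (f := fun u : S => φ u)
  exact ⟨x, x.2, hx⟩

theorem iSup_weight_pos (hφ : ∀ v, 0 < φ v) (hS : S.Nonempty) : 0 < ⨆ u : S, φ u := by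
  obtain ⟨x, -, hx⟩ := exists_eq_iSup_weight φ hS
  exact hx ▸ hφ x

theorem div_le_weightRatio (φ : V → ℝ) {u v : V} (hu : u ∈ S) (hv : v ∈ S) :
    φ u / φ v ≤ weightRatio φ S :=
  le_ciSup (f := fun p : S × S => φ p.1 / φ p.2) (Set.finite_range _).bddAbove (⟨u, hu⟩, ⟨v, hv⟩)

theorem exists_div_eq_weightRatio (φ : V → ℝ) (hS : S.Nonempty) :
    ∃ u ∈ S, ∃ v ∈ S, φ u / φ v = weightRatio φ S := by
  have := hS.to_subtype
  obtain ⟨⟨u, v⟩, h⟩ := exists_eq_ciSup_of_finite (f := fun p : S × S => φ p.1 / φ p.2)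
  exact ⟨u, u.2, v, v.2, h⟩

theorem one_le_weightRatio (hφ : ∀ v, 0 < φ v) (hS : S.Nonempty) : 1 ≤ weightRatio φ S := by
  obtain ⟨v, hv⟩ := hS
  simpa [(hφ v).ne'] using div_le_weightRatio φ hv hv

theorem weightRatio_le_adjRatio (φ : V → ℝ) (S : Finset V) :
    weightRatio φ S ≤ adjRatio φ S := by
  unfold adjRatio
  split_ifs <;> linarith

theorem adjRatio_le (hφ : ∀ v, 0 < φ v) (hS : S.Nonempty) :
    adjRatio φ S ≤ weightRatio φ S * 2 := by
  have := one_le_weightRatio hφ hS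
  unfold adjRatio
  split_ifs <;> linarith

theorem adjRatio_pos (hφ : ∀ v, 0 < φ v) (hS : S.Nonempty) : 0 < adjRatio φ S := by
  linarith [one_le_weightRatio hφ hS, weightRatio_le_adjRatio φ S]

theorem adjRatio_ne_two_pow (φ : V → ℝ) (S : Finset V) (k : ℕ) (h : 2 ^ k ≤ weightRatio φ S) :
    2 ^ k < adjRatio φ S := by
  unfold adjRatio
  split_ifs with hp
  · linarith
  · exact h.lt_of_ne fun h => hp ⟨k, h.symm⟩

/-- The ratio is raised only from some `2 ^ k` with `k < b`, and `2 ^ k + 1 ≤ 2 ^ (k + 1)`. -/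
theorem adjRatio_le_two_pow {b : ℕ} (h : weightRatio φ S < 2 ^ b) : adjRatio φ S ≤ 2 ^ b := by
  unfold adjRatio
  split_ifs with hp
  · obtain ⟨k, hk⟩ := hp
    rw [hk] at h ⊢
    have : k < b := (pow_lt_pow_iff_right₀ one_lt_two).1 h
    calc (2 : ℝ) ^ k + 1 ≤ 2 ^ k + 2 ^ k := by gcongr; exact one_le_pow₀ one_le_two
      _ = 2 ^ (k + 1) := by ring
      _ ≤ 2 ^ b := pow_le_pow_right₀ one_le_two this
  · exact h.le

theorem logb_adjRatio_le_natCast (hφ : ∀ v, 0 < φ v) (hS : S.Nonempty) {b : ℕ} :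
    Real.logb 2 (adjRatio φ S) ≤ b ↔ adjRatio φ S ≤ 2 ^ b := by
  rw [Real.logb_le_iff_le_rpow one_lt_two (adjRatio_pos hφ hS), Real.rpow_natCast]

theorem numClasses_le (hφ : ∀ v, 0 < φ v) (hS : S.Nonempty) {b : ℕ}
    (h : weightRatio φ S < 2 ^ b) : numClasses φ S ≤ b :=
  Nat.ceil_le.2 ((logb_adjRatio_le_natCast hφ hS).2 (adjRatio_le_two_pow h))

theorem weightRatio_lt_two_pow (hφ : ∀ v, 0 < φ v) (hS : S.Nonempty) :
    weightRatio φ S < 2 ^ numClasses φ S := by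
  by_contra! h
  have h1 := adjRatio_ne_two_pow φ S _ h
  have h2 := (logb_adjRatio_le_natCast hφ hS).1 (Nat.le_ceil (Real.logb 2 (adjRatio φ S)))
  exact h1.not_ge h2

theorem numClasses_pos (hφ : ∀ v, 0 < φ v) (hS : S.Nonempty) : 0 < numClasses φ S := by
  by_contra! h
  have := weightRatio_lt_two_pow hφ hS
  rw [Nat.le_zero.1 h, pow_zero] at this
  exact this.not_ge (one_le_weightRatio hφ hS)

theorem logb_adjRatio_le (hφ : ∀ v, 0 < φ v) (hS : S.Nonempty) :
    Real.logb 2 (adjRatio φ S) ≤ Real.logb 2 (weightRatio φ S) + 1 := by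
  have h1 := one_le_weightRatio hφ hS
  calc Real.logb 2 (adjRatio φ S) ≤ Real.logb 2 (weightRatio φ S * 2) :=
        Real.logb_le_logb_of_le one_lt_two (adjRatio_pos hφ hS) (adjRatio_le hφ hS)
    _ = _ := by
      rw [Real.logb_mul (by linarith) two_ne_zero, Real.logb_self_eq_one one_lt_two]

theorem natCast_lt_logb_adjRatio_iff (hφ : ∀ v, 0 < φ v) (hS : S.Nonempty) {R : ℕ} :
    (R : ℝ) < Real.logb 2 (adjRatio φ S) ↔ (R : ℝ) ≤ Real.logb 2 (weightRatio φ S) := by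
  rw [← not_le, logb_adjRatio_le_natCast hφ hS, not_le,
    Real.le_logb_iff_rpow_le one_lt_two (by linarith [one_le_weightRatio hφ hS]), Real.rpow_natCast]
  exact ⟨fun h => not_lt.1 fun h' => h.not_ge (adjRatio_le_two_pow h'), adjRatio_ne_two_pow φ S R⟩

theorem mem_weightClass {i : ℕ} {v : V} : v ∈ weightClass φ S i ↔
    v ∈ S ∧ (⨆ u : S, φ u) / 2 ^ (i + 1) < φ v ∧ φ v ≤ (⨆ u : S, φ u) / 2 ^ i := by
  simp [weightClass]

/-- Classes are open below, so the lightest vertex is covered only because `ρ < 2 ^ K` strictly;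
this is what the adjustment of `ρ` secures. -/
theorem exists_mem_weightClass (hφ : ∀ v, 0 < φ v) {v : V} (hv : v ∈ S) :
    ∃ i < numClasses φ S, v ∈ weightClass φ S i := by
  classical
  have hS : S.Nonempty := ⟨v, hv⟩
  have hlt : (⨆ u : S, φ u) / 2 ^ numClasses φ S < φ v := by
    obtain ⟨x, hx, h⟩ := exists_eq_iSup_weight φ hS
    rw [← h, div_lt_comm₀ (by positivity) (hφ v)]
    exact (div_le_weightRatio φ hx hv).trans_lt (weightRatio_lt_two_pow hφ hS)
  have hex : ∃ i, (⨆ u : S, φ u) / 2 ^ (i + 1) < φ v := by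
    refine ⟨numClasses φ S - 1, ?_⟩
    rwa [Nat.sub_add_cancel (numClasses_pos hφ hS)]
  refine ⟨Nat.find hex, ?_, mem_weightClass.2 ⟨hv, Nat.find_spec hex, ?_⟩⟩
  · have h1 := numClasses_pos hφ hS
    have h2 := Nat.find_min' hex (m := numClasses φ S - 1)
      (by rwa [Nat.sub_add_cancel (numClasses_pos hφ hS)])
    omega
  · rcases h0 : Nat.find hex with _ | i
    · simpa using le_iSup_weight φ hv
    · have := Nat.find_min hex (m := i) (by omega)
      exact not_lt.1 this

theorem iSup_weight_mul_tourLength_le (hφ : ∀ v, 0 < φ v) (htop : optOne φ ≠ ⊤)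
    {tour : Finset V → List V} (htour : ∀ S, IsApproxTour (3 / 2) S (tour S)) (hS : S.Nonempty)
    (i : ℕ) :
    (⨆ u : S, φ u) * tourLength (tour (weightClass φ S i)) ≤
      3 * 2 ^ i * (optOne φ).toReal := by
  have hM := iSup_weight_pos hφ hS
  have := mul_tourLength_le_optOne hφ htop (by norm_num) (htour (weightClass φ S i))
    (m := (⨆ u : S, φ u) / 2 ^ (i + 1)) (by positivity)
    fun v hv => (mem_weightClass.1 hv).2.1.le
  rw [div_mul_eq_mul_div, div_le_iff₀ (by positivity), pow_succ] at this
  linarith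

end Weights

/-! ### The assignment of many robots -/

/-- The `m`-th occurrence of `i`: each of the equally spaced offsets in a class is taken by an
actual robot. -/
theorem exists_getD_eq_count_take_eq {i : ℕ} {l : List ℕ} {m : ℕ} (hm : m < l.count i) :
    ∃ r < l.length, l.getD r 0 = i ∧ (l.take r).count i = m := by
  induction l generalizing m with
  | nil => simp at hm
  | cons a l ih =>
    by_cases ha : a = i
    · subst ha
      rcases m with _ | m
      · exact ⟨0, by simp⟩
      · obtain ⟨r, h1, h2, h3⟩ := ih (m := m) (by simpa using hm)
        exact ⟨r + 1, by simpa using h1, by simpa using h2, by simpa using h3⟩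
    · obtain ⟨r, h1, h2, h3⟩ := ih (m := m) (by simpa [List.count_cons, ha] using hm)
      exact ⟨r + 1, by simpa using h1, by simpa using h2, by simpa [List.count_cons, ha] using h3⟩

section Assignment

variable [Fintype V] (φ : V → ℝ) (tour : Finset V → List V) (R : ℕ)

theorem length_assignment (s : ℕ) : (assignment φ tour R s).length =
    numClasses φ (Finset.univ : Finset V) * (R / numClasses φ (Finset.univ : Finset V)) + s := by
  induction s with
  | zero => simp [assignment]
  | succ s ih => simp [assignment, ih, add_assoc]

theorem length_finalAssignment : (finalAssignment φ tour R).length = R := by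
  rw [finalAssignment, length_assignment]
  have := Nat.mul_div_le R (numClasses φ (Finset.univ : Finset V))
  omega

theorem le_count_assignment {i : ℕ} (hi : i < numClasses φ (Finset.univ : Finset V)) (s : ℕ) :
    R / numClasses φ (Finset.univ : Finset V) ≤ (assignment φ tour R s).count i := by
  induction s with
  | zero =>
    rw [assignment]
    have hmem : i ∈ List.range (numClasses φ (Finset.univ : Finset V)) := List.mem_range.2 hi
    obtain ⟨l₁, l₂, h⟩ := List.append_of_mem hmem
    rw [h]
    simp only [List.flatMap_append, List.flatMap_cons, List.count_append, List.count_replicate_self]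
    omega
  | succ s ih =>
    rw [assignment, List.count_append]
    omega

end Assignment

theorem maxCost_latencyWalks_le_of_many [Fintype V] {φ : V → ℝ} (hφ : ∀ v, 0 < φ v) {R : ℕ}
    {tour : Finset V → List V} (htour : ∀ S, IsApproxTour (3 / 2) S (tour S))
    (hR : ¬ (R : ℝ) < Real.logb 2 (adjRatio φ (Finset.univ : Finset V))) :
    maxCost φ (latencyWalks φ tour R) ≤
      3 * optOne φ / ((R / numClasses φ (Finset.univ : Finset V) : ℕ) : ℝ≥0∞) := by
  have hS : (Finset.univ : Finset V).Nonempty := Finset.univ_nonempty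
  have hK := numClasses_pos hφ hS
  have hKR : numClasses φ (Finset.univ : Finset V) ≤ R := Nat.ceil_le.2 (not_lt.1 hR)
  have hf : 0 < R / numClasses φ (Finset.univ : Finset V) := Nat.div_pos hKR hK
  set f := R / numClasses φ (Finset.univ : Finset V) with hfdef
  by_cases htop : optOne φ = ⊤
  · rw [htop, ENNReal.mul_top (by simp), ENNReal.top_div_of_ne_top (ENNReal.natCast_ne_top f)]
    exact le_top
  have hf' : (0 : ℝ) < f := by exact_mod_cast hf
  have hrhs : 3 * optOne φ / (f : ℝ≥0∞) = ENNReal.ofReal (3 * (optOne φ).toReal / f) := by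
    rw [ENNReal.ofReal_div_of_pos hf', ENNReal.ofReal_mul (by norm_num),
      ENNReal.ofReal_toReal htop, ENNReal.ofReal_natCast]
    norm_num
  rw [hrhs]
  refine iSup_le fun v => ?_
  obtain ⟨i, hi, hv⟩ := exists_mem_weightClass hφ (Finset.mem_univ v)
  set S := weightClass φ Finset.univ i with hSdef
  set n := (finalAssignment φ tour R).count i with hn
  have hfn : f ≤ n := le_count_assignment φ tour R hi _
  have hn0 : 0 < n := hf.trans_le hfn
  have hlat : latency (latencyWalks φ tour R) v ≤ ENNReal.ofReal (tourLength (tour S) / n) := by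
    refine latency_le fun t ht => ?_
    obtain ⟨m, hm, t', h1, h2, h3⟩ := exists_present_spacedWalk (htour S).1.1
      (((htour S).1.2 v).2 hv) hn0 ht
    obtain ⟨r, hr, hri, hrm⟩ := exists_getD_eq_count_take_eq hm
    rw [length_finalAssignment] at hr
    refine ⟨t', h1, h2, Present.of_single ⟨r, hr⟩ ?_⟩
    simp only [latencyWalks, if_neg hR, hri, hrm]
    exact h3
  calc ENNReal.ofReal (φ v) * latency (latencyWalks φ tour R) v
      ≤ ENNReal.ofReal (φ v) * ENNReal.ofReal (tourLength (tour S) / n) := by gcongr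
    _ = ENNReal.ofReal (φ v * (tourLength (tour S) / n)) := by
      rw [ENNReal.ofReal_mul (hφ v).le]
    _ ≤ ENNReal.ofReal (3 * (optOne φ).toReal / f) := ENNReal.ofReal_le_ofReal ?_
  have h1 := iSup_weight_mul_tourLength_le hφ htop htour hS i
  have h2 := (mem_weightClass.1 hv).2.2
  rw [le_div_iff₀ (by positivity)] at h2
  have hT := tourLength_nonneg (tour S)
  have h3 : φ v * tourLength (tour S) ≤ 3 * (optOne φ).toReal := by
    have h4 := mul_le_mul_of_nonneg_right h2 hT
    refine le_of_mul_le_mul_right ?_ (by positivity : (0 : ℝ) < 2 ^ i)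
    calc _ = φ v * 2 ^ i * tourLength (tour S) := by ring
      _ ≤ _ := h4.trans h1
      _ = _ := by ring
  rw [← mul_div_assoc]
  have : (f : ℝ) ≤ n := by exact_mod_cast hfn
  gcongr

/-! ### Periodic concatenations of walks -/

section Concatenation

/-- The concatenation of the first `n` lists of a sequence. -/
def concat (pc : ℕ → List V) (n : ℕ) : List V := (List.range n).flatMap pc

variable {pc : ℕ → List V} {A : ℕ}

theorem concat_succ (pc : ℕ → List V) (n : ℕ) : concat pc (n + 1) = concat pc n ++ pc n := by
  simp [concat, List.range_succ]

theorem concat_prefix (pc : ℕ → List V) {n m : ℕ} (h : n ≤ m) : concat pc n <+: concat pc m := by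
  induction m, h using Nat.le_induction with
  | base => exact List.prefix_rfl
  | succ m _ ih => exact ih.trans (by rw [concat_succ]; exact List.prefix_append _ _)

theorem concat_add (hper : ∀ n, pc (A + n) = pc n) (n : ℕ) :
    concat pc (A + n) = concat pc A ++ concat pc n := by
  induction n with
  | zero => simp [concat]
  | succ n ih => rw [← add_assoc, concat_succ, ih, hper, concat_succ, List.append_assoc]

theorem length_concat_mul (hper : ∀ n, pc (A + n) = pc n) (N : ℕ) :
    (concat pc (N * A)).length = N * (concat pc A).length := by
  induction N with
  | zero => simp [concat]
  | succ N ih => rw [Nat.succ_mul, add_comm, concat_add hper, List.length_append, ih]; ring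

/-- Repeating the period list agrees with the infinite concatenation of the periodic pieces, so
positions can be located by piece number. -/
theorem cyc_concat (hA : 0 < A) (hper : ∀ n, pc (A + n) = pc n) {n i : ℕ}
    (hi : i < (concat pc n).length) : cyc (concat pc A) i = (concat pc n)[i] := by
  induction n using Nat.strong_induction_on generalizing i with
  | _ n ih =>
    rcases le_or_gt n A with hn | hn
    · have h := concat_prefix pc hn
      rw [h.getElem hi, cyc_of_lt _ (hi.trans_le h.length_le)]
    · obtain ⟨n, rfl⟩ := Nat.exists_eq_add_of_le hn.le
      simp only [concat_add hper, List.length_append] at hi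
      simp only [concat_add hper]
      rcases lt_or_ge i (concat pc A).length with h | h
      · rw [List.getElem_append_left h, cyc_of_lt _ h]
      · rw [List.getElem_append_right h, ← ih n (by omega)]
        have := cyc_mul_add (concat pc A) 1 (i - (concat pc A).length)
        rw [one_mul, Nat.add_sub_cancel' h] at this
        exact this

theorem cyc_concat_add (hA : 0 < A) (hper : ∀ n, pc (A + n) = pc n) {n r : ℕ}
    (hr : r < (pc n).length) :
    cyc (concat pc A) ((concat pc n).length + r) = cyc (pc n) r := by
  have hlt : (concat pc n).length + r < (concat pc (n + 1)).length := by
    rw [concat_succ, List.length_append]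
    omega
  rw [cyc_concat hA hper hlt, cyc_of_lt _ hr]
  simp [concat_succ]

theorem concat_ne_nil (hA : 0 < A) (hper : ∀ n, pc (A + n) = pc n) {n : ℕ} (hn : pc n ≠ []) :
    concat pc A ≠ [] := by
  intro h
  have h0 : (concat pc ((n + 1) * A)).length = 0 := by
    rw [length_concat_mul hper, h]
    simp
  have h1 := (concat_prefix pc (Nat.le_mul_of_pos_right (n + 1) hA)).length_le
  have h2 := List.length_pos_iff.2 hn
  rw [concat_succ, List.length_append] at h1
  omega

theorem mem_concat (hA : 0 < A) (hper : ∀ n, pc (A + n) = pc n) {n : ℕ} {v : V}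
    (hv : v ∈ pc n) : v ∈ concat pc A := by
  obtain ⟨r, hr, rfl⟩ := exists_cyc_eq hv
  rw [← cyc_concat_add hA hper hr]
  exact cyc_mem (concat_ne_nil hA hper (List.ne_nil_of_mem hv)) _

/-- A nonempty piece costs its inner edges (`Q`) and one link to the next vertex (`D`); an empty
piece costs nothing. -/
theorem cumLen_concat_succ_le (hA : 0 < A) (hper : ∀ n, pc (A + n) = pc n) {Q D : ℝ}
    (hQ : ∀ n, cumLen (pc n) ((pc n).length - 1) ≤ Q) (hQ0 : 0 ≤ Q) (hD0 : 0 ≤ D)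
    (hD : ∀ u ∈ concat pc A, ∀ w ∈ concat pc A, dist u w ≤ D) (n : ℕ) :
    cumLen (concat pc A) (concat pc (n + 1)).length ≤
      cumLen (concat pc A) (concat pc n).length + (Q + D) := by
  rw [concat_succ, List.length_append]
  rcases hlen : (pc n).length with _ | m
  · simp only [add_zero]
    linarith
  · have hne : concat pc A ≠ [] :=
      concat_ne_nil hA hper (n := n) (List.ne_nil_of_length_eq_add_one hlen)
    have h1 := hQ n
    rw [hlen, Nat.add_sub_cancel] at h1
    have h2 : cumLen (pc n) m = ∑ s ∈ Finset.range m,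
        dist (cyc (concat pc A) ((concat pc n).length + s))
          (cyc (concat pc A) ((concat pc n).length + s + 1)) := by
      refine Finset.sum_congr rfl fun s hs => ?_
      have := Finset.mem_range.1 hs
      rw [cyc_concat_add hA hper (by omega), add_assoc, cyc_concat_add hA hper (by omega)]
    have h3 := hD _ (cyc_mem hne ((concat pc n).length + m)) _
      (cyc_mem hne ((concat pc n).length + m + 1))
    rw [cumLen, Finset.sum_range_add, Finset.sum_range_succ]
    simp only [← add_assoc]
    rw [← h2]
    change cumLen _ _ + _ + _ ≤ _
    linarith

/-- If piece `n` is under way at time `t`, some piece `n'` with `n < n' ≤ n + B` contains `v`. At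
most `B + 1` pieces, counting the current one, are traversed until then. -/
theorem exists_present_concat (hA : 0 < A) (hper : ∀ n, pc (A + n) = pc n) {E : ℝ}
    (hE : ∀ n, cumLen (concat pc A) (concat pc (n + 1)).length ≤
      cumLen (concat pc A) (concat pc n).length + E) (hT : tourLength (concat pc A) ≠ 0) {v : V}
    {B : ℕ} (hv : ∀ n, ∃ n', n < n' ∧ n' ≤ n + B ∧ v ∈ pc n') {t : ℝ} (ht : 0 ≤ t) :
    ∃ t', t ≤ t' ∧ t' ≤ t + (B + 1) * E ∧
      Present (fun _ : Unit => tourWalk (concat pc A) 0 0) v t' := by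
  classical
  set P := concat pc A with hP
  have hE0 : 0 ≤ E := by
    have := (cumLen_mono P (concat_prefix pc (Nat.zero_le 1)).length_le).trans (hE 0)
    linarith
  have hT' : 0 < tourLength P := (tourLength_nonneg P).lt_of_ne' hT
  have hex : ∃ n, t < cumLen P (concat pc n).length := by
    obtain ⟨N, hN⟩ := exists_nat_gt (t / tourLength P)
    rw [div_lt_iff₀ hT', ← cumLen_mul, hP, ← length_concat_mul hper] at hN
    exact ⟨_, hN⟩
  have h0 : Nat.find hex ≠ 0 := by
    intro h
    have := Nat.find_spec hex
    rw [h] at this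
    simp [concat, cumLen_zero] at this
    linarith
  obtain ⟨n, hn⟩ := Nat.exists_eq_succ_of_ne_zero h0
  have h1 : cumLen P (concat pc n).length ≤ t := not_lt.1 (Nat.find_min hex (by omega))
  have h2 : t < cumLen P (concat pc (n + 1)).length := by
    have := Nat.find_spec hex
    rwa [hn] at this
  obtain ⟨n', hnn', hn'B, hvn'⟩ := hv n
  obtain ⟨r, hr, rfl⟩ := exists_cyc_eq hvn'
  have hpres := present_tourWalk hT (Nat.zero_le ((concat pc n').length + r)) le_rfl
  rw [cyc_concat_add hA hper hr, cumLen_zero, zero_add, sub_zero] at hpres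
  refine ⟨_, ?_, ?_, hpres⟩
  · exact h2.le.trans (cumLen_mono P
      ((concat_prefix pc (Nat.succ_le_iff.2 hnn')).length_le.trans (Nat.le_add_right _ _)))
  · have h3 : ∀ j : ℕ, cumLen P (concat pc (n + j)).length ≤
        cumLen P (concat pc n).length + j * E := by
      intro j
      induction j with
      | zero => simp
      | succ j ih =>
        have := hE (n + j)
        rw [← add_assoc]
        push_cast
        linarith
    have h4 := h3 (B + 1)
    have h5 : (concat pc n').length + r ≤ (concat pc (n + (B + 1))).length := by
      refine le_trans ?_ (concat_prefix pc (show n' + 1 ≤ n + (B + 1) by omega)).length_le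
      rw [concat_succ, List.length_append]
      omega
    have h6 := cumLen_mono P h5
    push_cast at h4
    linarith

theorem flatMap_range_flatMap_range (f : ℕ → ℕ → List V) (A : ℕ) {K : ℕ} (hK : 0 < K) :
    ((List.range A).flatMap fun k => (List.range K).flatMap fun i => f k i) =
      concat (fun n => f (n / K) (n % K)) (A * K) := by
  induction A with
  | zero => simp [concat]
  | succ A ih =>
    rw [List.range_succ, List.flatMap_append, ih, Nat.succ_mul, concat, concat, List.range_add,
      List.flatMap_append]
    congr 1
    simp only [List.flatMap_cons, List.flatMap_nil, List.append_nil, List.flatMap_map]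
    refine List.flatMap_congr fun i hi => ?_
    have := List.mem_range.1 hi
    rw [mul_comm A K, Nat.mul_add_div hK, Nat.div_eq_of_lt this, Nat.mul_add_mod,
      Nat.mod_eq_of_lt this, add_zero]

end Concatenation

/-! ### Cutting a tour -/

/-- The positions kept increase along the tour and lie within `T / N` of each other, so shortcutting
suffices. The `- 1` leaves out the closing edge. -/
theorem cumLen_piece_le (l : List V) {N : ℕ} (hN : 0 < N) (j : ℕ) :
    cumLen (piece l N j) ((piece l N j).length - 1) ≤ tourLength l / N := by
  classical
  set Q := (List.range l.length).filter fun q => ⌊cumLen l q * N / tourLength l⌋₊ = j with hQ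
  have hpiece : piece l N j = Q.map (cyc l) := by
    simp only [piece, hQ]
  have hN' : (0 : ℝ) < N := by exact_mod_cast hN
  have hT0 := tourLength_nonneg l
  rw [hpiece, List.length_map]
  rcases hlen : Q.length with _ | m
  · simp only [Nat.zero_sub, cumLen_zero]
    positivity
  have hsort : Q.Pairwise (· < ·) := List.Pairwise.filter _ List.pairwise_lt_range
  have hmem : ∀ s ≤ m, Q.getD s 0 < l.length ∧
      ⌊cumLen l (Q.getD s 0) * N / tourLength l⌋₊ = j := by
    intro s hs
    have : Q.getD s 0 ∈ Q := by
      rw [List.getD_eq_getElem _ _ (by omega)]; exact List.getElem_mem _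
    simpa [hQ] using this
  have hmono : ∀ s < m, Q.getD s 0 ≤ Q.getD (s + 1) 0 := by
    intro s hs
    rw [List.getD_eq_getElem _ _ (by omega), List.getD_eq_getElem _ _ (by omega)]
    exact (List.pairwise_iff_getElem.1 hsort s (s + 1) _ _ (by omega)).le
  obtain ⟨h1, h2⟩ := sum_dist_comp_le (cyc l) (fun s => Q.getD s 0) hmono
  have hcyc : ∀ s ≤ m, cyc (Q.map (cyc l)) s = cyc l (Q.getD s 0) := by
    intro s hs
    rw [cyc_of_lt _ (by simp; omega), List.getElem_map, List.getD_eq_getElem _ _ (by omega)]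
  rw [Nat.add_sub_cancel, cumLen, Finset.sum_congr rfl fun s hs => by
    rw [hcyc s (Finset.mem_range.1 hs).le, hcyc (s + 1) (Finset.mem_range.1 hs)]]
  refine h2.trans ?_
  rw [Finset.sum_Ico_eq_sub _ h1]
  change cumLen l (Q.getD m 0) - cumLen l (Q.getD 0 0) ≤ _
  rcases hT0.eq_or_lt with hT | hT
  · have h3 := cumLen_mono l (hmem m le_rfl).1.le
    change _ ≤ tourLength l at h3
    have h4 := cumLen_nonneg l (Q.getD 0 0)
    rw [← hT] at h3 ⊢
    simp only [zero_div]
    linarith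
  · have h3 := Nat.lt_floor_add_one (cumLen l (Q.getD m 0) * N / tourLength l)
    have h4 := Nat.floor_le (show 0 ≤ cumLen l (Q.getD 0 0) * N / tourLength l from
      div_nonneg (mul_nonneg (cumLen_nonneg l _) hN'.le) hT0)
    rw [(hmem m le_rfl).2, div_lt_iff₀ hT] at h3
    rw [(hmem 0 (Nat.zero_le m)).2, le_div_iff₀ hT] at h4
    rw [le_div_iff₀ hN']
    linarith

theorem mem_of_mem_piece {l : List V} {N j : ℕ} {v : V} (h : v ∈ piece l N j) : v ∈ l := by
  simp only [piece, List.mem_map, List.mem_filter, List.mem_range] at h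
  obtain ⟨q, ⟨hq, -⟩, rfl⟩ := h
  rw [cyc_of_lt l hq]
  exact List.getElem_mem hq

theorem exists_mem_piece {l : List V} (hl : l.Nodup) {v : V} (hv : v ∈ l) {N : ℕ} (hN : 0 < N) :
    ∃ j < N, v ∈ piece l N j := by
  obtain ⟨q, hq, rfl⟩ := exists_cyc_eq hv
  refine ⟨⌊cumLen l q * N / tourLength l⌋₊, ?_, ?_⟩
  · by_cases hT : tourLength l = 0
    -- Division by zero gives `0`, so everything falls into piece `0`.
    · simpa [hT] using hN
    · have hT' : 0 < tourLength l := (tourLength_nonneg l).lt_of_ne' hT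
      have hN' : (0 : ℝ) < N := by exact_mod_cast hN
      rw [Nat.floor_lt (div_nonneg (mul_nonneg (cumLen_nonneg l _) hN'.le) hT'.le),
        div_lt_iff₀ hT', mul_comm]
      exact mul_lt_mul_of_pos_left (cumLen_lt_tourLength hl hT hq) hN'
  · simp only [piece, List.mem_map, List.mem_filter, List.mem_range]
    exact ⟨q, ⟨hq, by simp⟩, rfl⟩

/-! ### The single-robot algorithm -/

theorem exists_modEq_mem_Ioc (n c : ℕ) {B : ℕ} (hB : 0 < B) :
    ∃ y, n < y ∧ y ≤ n + B ∧ y ≡ c [MOD B] := by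
  refine ⟨n + 1 + (c + (B - 1) * (n + 1)) % B, by omega, ?_, ?_⟩
  · have := Nat.mod_lt (c + (B - 1) * (n + 1)) hB
    omega
  · calc n + 1 + (c + (B - 1) * (n + 1)) % B ≡ n + 1 + (c + (B - 1) * (n + 1)) [MOD B] :=
          (Nat.mod_modEq _ _).add_left _
      _ = c + B * (n + 1) := by
        obtain ⟨b, rfl⟩ := Nat.exists_eq_succ_of_ne_zero hB.ne'
        rw [Nat.succ_sub_one, Nat.succ_eq_add_one]
        ring
      _ ≡ c [MOD B] := by simp [Nat.ModEq]

theorem exists_block_mem_Ioc (n : ℕ) {K i j N : ℕ} (hi : i < K) (hj : j < N) :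
    ∃ y, n < y ∧ y ≤ n + K * N ∧ y % K = i ∧ (y / K + 1) % N = j := by
  have hK : 0 < K := by omega
  have hN : 0 < N := by omega
  -- The target block is `j - 1` modulo `N`, as block `y / K` uses the piece numbered `y / K + 1`;
  -- adding `N` avoids truncated subtraction.
  obtain ⟨y, h1, h2, h3⟩ := exists_modEq_mem_Ioc n (K * (j + N - 1) + i) (Nat.mul_pos hK hN)
  refine ⟨y, h1, h2, ?_, ?_⟩
  · have : y % K = (K * (j + N - 1) + i) % K := Nat.ModEq.of_mul_right N h3
    rw [this, Nat.mul_add_mod, Nat.mod_eq_of_lt hi]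
  · have h4 : y / K ≡ j + N - 1 [MOD N] := by
      rw [Nat.ModEq, ← Nat.mod_mul_right_div_self, h3, Nat.mod_mul_right_div_self,
        Nat.mul_add_div hK, Nat.div_eq_of_lt hi, add_zero]
    have h5 : (y / K + 1) % N = (j + N - 1 + 1) % N := h4.add_right 1
    rw [h5, Nat.sub_add_cancel (by omega), Nat.add_mod_right, Nat.mod_eq_of_lt hj]

theorem exists_present_singleRobotWalk {φ : V → ℝ} (hφ : ∀ v, 0 < φ v) (htop : optOne φ ≠ ⊤)
    {tour : Finset V → List V} (htour : ∀ S, IsApproxTour (3 / 2) S (tour S)) {S : Finset V}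
    {v : V} (hv : v ∈ S) :
    ∃ L, φ v * L ≤ 4 * (numClasses φ S + 1) * (optOne φ).toReal ∧ ∀ t, 0 ≤ t →
      ∃ t', t ≤ t' ∧ t' ≤ t + L ∧ Present (fun _ : Unit => singleRobotWalk φ tour S) v t' := by
  have hS : S.Nonempty := ⟨v, hv⟩
  have hM := iSup_weight_pos hφ hS
  obtain ⟨x, hx, hxM⟩ := exists_eq_iSup_weight φ hS
  obtain ⟨i, hi, hvi⟩ := exists_mem_weightClass hφ hv
  have hK := numClasses_pos hφ hS
  set K := numClasses φ S with hKdef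
  set M := ⨆ u : S, φ u with hMdef
  set o := (optOne φ).toReal with ho
  have ho0 : 0 ≤ o := ENNReal.toReal_nonneg
  set pc : ℕ → List V := fun n =>
    piece (tour (weightClass φ S (n % K))) (2 ^ (n % K)) ((n / K + 1) % 2 ^ (n % K)) with hpc
  set A := 2 ^ K * K with hAdef
  have hA : 0 < A := by positivity
  have hperiod : singleRobotPeriod φ tour S = concat pc A :=
    flatMap_range_flatMap_range (fun k i =>
      piece (tour (weightClass φ S i)) (2 ^ i) ((k + 1) % 2 ^ i)) (2 ^ K) hK
  have hper : ∀ n, pc (A + n) = pc n := by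
    intro n
    have h1 : (A + n) % K = n % K := by simp [hAdef]
    have h2 : (A + n) / K = 2 ^ K + n / K := by
      rw [hAdef, mul_comm, Nat.mul_add_div hK]
    have h3 : (2 ^ K + n / K + 1) % 2 ^ (n % K) = (n / K + 1) % 2 ^ (n % K) := by
      obtain ⟨d, hd⟩ := pow_dvd_pow 2 (Nat.mod_lt n hK).le
      rw [hd, add_assoc, Nat.mul_add_mod]
    simp only [hpc, h1, h2, h3]
  have hmemS : ∀ u ∈ concat pc A, u ∈ S := by
    intro u hu
    simp only [concat, List.mem_flatMap] at hu
    obtain ⟨n, -, hu⟩ := hu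
    exact (mem_weightClass.1 (((htour _).1.2 u).1 (mem_of_mem_piece hu))).1
  -- Both vertices are within `o / (2 * M)` of the heaviest vertex `x`.
  have hD : ∀ u ∈ concat pc A, ∀ w ∈ concat pc A, dist u w ≤ o / M := by
    intro u _ w _
    have h1 := mul_dist_le_optOne hφ htop x u
    have h2 := mul_dist_le_optOne hφ htop x w
    rw [hxM] at h1 h2
    rw [le_div_iff₀ hM]
    have h3 := mul_le_mul_of_nonneg_right (dist_triangle_left u w x) hM.le
    linarith
  have hQ : ∀ n, cumLen (pc n) ((pc n).length - 1) ≤ 3 * o / M := by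
    intro n
    refine (cumLen_piece_le _ (by positivity) _).trans ?_
    have h1 := iSup_weight_mul_tourLength_le hφ htop htour hS (n % K)
    rw [div_le_div_iff₀ (by positivity) hM]
    push_cast
    linarith
  obtain ⟨j, hj, hvj⟩ := exists_mem_piece (htour _).1.1 (((htour _).1.2 v).2 hvi)
    (N := 2 ^ i) (by positivity)
  have hvisit : ∀ n, ∃ n', n < n' ∧ n' ≤ n + K * 2 ^ i ∧ v ∈ pc n' := by
    intro n
    obtain ⟨y, h1, h2, h3, h4⟩ := exists_block_mem_Ioc n hi hj
    refine ⟨y, h1, h2, ?_⟩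
    simp only [hpc, h3, h4]
    exact hvj
  refine ⟨((K * 2 ^ i : ℕ) + 1) * (3 * o / M + o / M), ?_, fun t ht => ?_⟩
  · have h1 := (mem_weightClass.1 hvi).2.2
    have h2 : (1 : ℝ) ≤ 2 ^ i := one_le_pow₀ one_le_two
    calc φ v * (((K * 2 ^ i : ℕ) + 1) * (3 * o / M + o / M))
        ≤ M / 2 ^ i * (((K * 2 ^ i : ℕ) + 1) * (3 * o / M + o / M)) := by gcongr
      _ = 4 * o * ((K * 2 ^ i + 1) / 2 ^ i) := by
        push_cast
        field_simp
        ring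
      _ ≤ 4 * o * (K + 1) := by
        gcongr
        rw [div_le_iff₀ (by positivity)]
        linarith
      _ = _ := by ring
  · rw [singleRobotWalk, hperiod]
    by_cases hT : tourLength (concat pc A) = 0
    · obtain ⟨n, -, -, hn⟩ := hvisit 0
      refine ⟨t, le_rfl, ?_,
        present_tourWalk_of_tourLength_eq_zero hT (mem_concat hA hper hn) _ _ ht⟩
      have : 0 ≤ ((K * 2 ^ i : ℕ) + 1) * (3 * o / M + o / M) := by positivity
      linarith
    · exact exists_present_concat hA hper
        (cumLen_concat_succ_le hA hper hQ (by positivity) (by positivity) hD) hT hvisit ht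

/-- The weights of the part lie in `(M / 2 ^ b, M / 2 ^ a]`, so their ratio is strictly below `2 ^
(b - a)`, even though the part is reclassified by its own maximum. -/
theorem numClasses_robotPart_le [Fintype V] {φ : V → ℝ} (hφ : ∀ v, 0 < φ v) {R j : ℕ}
    (hS : (robotPart φ R j).Nonempty) :
    numClasses φ (robotPart φ R j) ≤
      ⌈((j : ℝ) + 1) / R * Real.logb 2 (adjRatio φ Finset.univ)⌉₊ -
        ⌈(j : ℝ) / R * Real.logb 2 (adjRatio φ Finset.univ)⌉₊ := by
  set b := ⌈((j : ℝ) + 1) / R * Real.logb 2 (adjRatio φ Finset.univ)⌉₊ with hb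
  set a := ⌈(j : ℝ) / R * Real.logb 2 (adjRatio φ Finset.univ)⌉₊ with ha
  have hM := iSup_weight_pos hφ (Finset.univ_nonempty (α := V))
  refine numClasses_le hφ hS ?_
  obtain ⟨u, hu, w, hw, h⟩ := exists_div_eq_weightRatio φ hS
  rw [← h]
  simp only [robotPart, Finset.mem_filter, Finset.mem_univ, true_and] at hu hw
  obtain ⟨i, hai, -, hui⟩ := hu
  obtain ⟨k, hak, hkb, hwk⟩ := hw
  rw [← ha] at hai hak
  rw [← hb] at hkb
  set M := ⨆ u : (Finset.univ : Finset V), φ u with hMdef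
  have h1 : φ u ≤ M / 2 ^ a := (mem_weightClass.1 hui).2.2.trans (by gcongr; norm_num)
  have h2 : M / 2 ^ b < φ w := lt_of_le_of_lt (by gcongr; norm_num; omega) (mem_weightClass.1 hwk).2.1
  have h3 : (2 : ℝ) ^ b = 2 ^ (b - a) * 2 ^ a := by
    rw [← pow_add, Nat.sub_add_cancel (by omega)]
  rw [div_lt_iff₀ (hφ w)]
  refine h1.trans_lt ?_
  rw [div_lt_iff₀ (by positivity)] at h2 ⊢
  rw [h3] at h2
  linarith

theorem maxCost_latencyWalks_le_of_few [Fintype V] {φ : V → ℝ} (hφ : ∀ v, 0 < φ v) {R : ℕ}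
    (hR0 : 0 < R) {tour : Finset V → List V} (htour : ∀ S, IsApproxTour (3 / 2) S (tour S))
    (hR : (R : ℝ) ≤ Real.logb 2 (weightRatio φ (Finset.univ : Finset V))) :
    maxCost φ (latencyWalks φ tour R) ≤
      ENNReal.ofReal (8 * Real.logb 2 (weightRatio φ (Finset.univ : Finset V)) / R + 10) *
        optOne φ := by
  classical
  have hS : (Finset.univ : Finset V).Nonempty := Finset.univ_nonempty
  have hR' : (0 : ℝ) < R := by exact_mod_cast hR0
  have hif := (natCast_lt_logb_adjRatio_iff hφ hS).2 hR
  have hadj := logb_adjRatio_le hφ hS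
  set g := Real.logb 2 (weightRatio φ (Finset.univ : Finset V)) with hg
  have hcoef : 0 < 8 * g / R + 10 := by
    have : 0 ≤ g := hR'.le.trans hR
    positivity
  by_cases htop : optOne φ = ⊤
  · rw [htop, ENNReal.mul_top (by simpa using hcoef)]
    exact le_top
  rw [← ENNReal.ofReal_toReal htop, ← ENNReal.ofReal_mul hcoef.le]
  refine iSup_le fun v => ?_
  obtain ⟨i, hi, hv⟩ := exists_mem_weightClass hφ (Finset.mem_univ v)
  rw [numClasses] at hi
  set h := Real.logb 2 (adjRatio φ (Finset.univ : Finset V)) with hh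
  have hlast : i < ⌈(((R - 1 : ℕ) : ℝ) + 1) / R * h⌉₊ := by
    have : ((R - 1 : ℕ) : ℝ) + 1 = R := by
      exact_mod_cast Nat.sub_add_cancel hR0
    rwa [this, div_self hR'.ne', one_mul]
  have hex : ∃ j : ℕ, i < ⌈((j : ℝ) + 1) / R * h⌉₊ := ⟨R - 1, hlast⟩
  -- The index intervals of the robots tile `[0, K)`; the first one ending beyond `i` contains `i`.
  obtain ⟨j, hjR, hj1, hj2⟩ : ∃ j < R, ⌈(j : ℝ) / R * h⌉₊ ≤ i ∧ i < ⌈((j : ℝ) + 1) / R * h⌉₊ := by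
    refine ⟨Nat.find hex, ?_, ?_, Nat.find_spec hex⟩
    · have := Nat.find_min' hex hlast
      omega
    · rcases h0 : Nat.find hex with _ | j
      · simp
      · have := Nat.find_min hex (m := j) (by omega)
        push_cast
        exact not_lt.1 this
  have hvS : v ∈ robotPart φ R j := by
    simp only [robotPart, Finset.mem_filter, Finset.mem_univ, true_and]
    exact ⟨i, hj1, hj2, hv⟩
  obtain ⟨L, hL, hpres⟩ := exists_present_singleRobotWalk hφ htop htour hvS
  have hlat : latency (latencyWalks φ tour R) v ≤ ENNReal.ofReal L := by
    refine latency_le fun t ht => ?_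
    obtain ⟨t', h1, h2, h3⟩ := hpres t ht
    refine ⟨t', h1, h2, Present.of_single ⟨j, hjR⟩ ?_⟩
    simp only [latencyWalks]
    rw [if_pos hif]
    exact h3
  calc ENNReal.ofReal (φ v) * latency (latencyWalks φ tour R) v
      ≤ ENNReal.ofReal (φ v) * ENNReal.ofReal L := by gcongr
    _ = ENNReal.ofReal (φ v * L) := by rw [ENNReal.ofReal_mul (hφ v).le]
    _ ≤ _ := ENNReal.ofReal_le_ofReal (hL.trans ?_)
  refine mul_le_mul_of_nonneg_right ?_ ENNReal.toReal_nonneg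
  have hcard : (numClasses φ (robotPart φ R j) : ℝ) ≤ h / R + 1 := by
    have h1 : (numClasses φ (robotPart φ R j) : ℝ) + ⌈(j : ℝ) / R * h⌉₊ ≤
        ⌈((j : ℝ) + 1) / R * h⌉₊ := by
      have := numClasses_robotPart_le hφ ⟨v, hvS⟩
      rw [← hh] at this
      exact_mod_cast (by omega : numClasses φ (robotPart φ R j) + ⌈(j : ℝ) / R * h⌉₊ ≤
        ⌈((j : ℝ) + 1) / R * h⌉₊)
    have h0 : 0 ≤ h := hR'.le.trans hif.le
    have h2 := Nat.le_ceil ((j : ℝ) / R * h)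
    have h3 := Nat.ceil_lt_add_one (show 0 ≤ ((j : ℝ) + 1) / R * h by positivity)
    have h4 : ((j : ℝ) + 1) / R * h = (j : ℝ) / R * h + h / R := by ring
    linarith
  have h5 : h / R ≤ g / R + 1 := by
    have h6 : (1 : ℝ) ≤ R := by exact_mod_cast hR0
    rw [div_add_one hR'.ne']
    gcongr
    linarith
  -- The class count is at most `g / R + 2`, so the factor is at most `4 * (g / R) + 12`; `g / R ≥
  -- 1` absorbs the excess over `10`.
  have h7 : 1 ≤ g / R := (one_le_div hR').2 hR
  have h8 : 8 * g / R = 8 * (g / R) := by ring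
  linarith

end Patrol

theorem mainTheorem7 {V : Type*} [MetricSpace V] [Fintype V] [Nonempty V]
    (φ : V → ℝ) (hφ : ∀ v, 0 < φ v) (R : ℕ) (hR : 0 < R)
    (tour : Finset V → List V) (htour : ∀ S, Patrol.IsApproxTour (3 / 2) S (tour S)) :
    ((R : ℝ) ≤ Real.logb 2 (Patrol.weightRatio φ Finset.univ) →
      Patrol.maxCost φ (Patrol.latencyWalks φ tour R) ≤
        ENNReal.ofReal (8 * Real.logb 2 (Patrol.weightRatio φ Finset.univ) / R + 10) *
          Patrol.optOne φ) ∧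
    (Real.logb 2 (Patrol.weightRatio φ Finset.univ) < (R : ℝ) →
      Patrol.maxCost φ (Patrol.latencyWalks φ tour R) ≤
        3 * Patrol.optOne φ /
          ((⌊(R : ℝ) / (⌈Real.logb 2 (Patrol.adjRatio φ Finset.univ)⌉₊ : ℝ)⌋₊ : ℕ) : ENNReal)) := by
  refine ⟨Patrol.maxCost_latencyWalks_le_of_few hφ hR htour, fun h => ?_⟩
  rw [Nat.floor_div_eq_div]
  refine Patrol.maxCost_latencyWalks_le_of_many hφ htour fun h' => ?_
  exact h.not_ge ((Patrol.natCast_lt_logb_adjRatio_iff hφ Finset.univ_nonempty).1 h')
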